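/- Let $\mathcal A$ be an Archimedean real vector lattice with an associative bilinear multiplication (possibly without a unit) that makes it an $f$-algebra: $ab\ge 0$ whenever $a,b\ge 0$, and $a\wedge b=0$, $c\ge 0$ imply $(ac)\wedge b=(ca)\wedge b=0$. Assume that $\mathcal A$ is semiprime (zero is its only nilpotent element) and uniformly complete (for every $u\ge 0$, every sequence $(f_n)$ such that for each $\varepsilon>0$ one has $|f_m-f_n|\le\varepsilon u$ for all large $m,n$ admits $f\in\mathcal A$ such that for each $\varepsilon>0$ one has $|f_n-f|\le\varepsilon u$ for all large $n$). For a vector lattice $V$, an element $z\ge 0$ of $V$ is a majorant of $\varphi\in V$ if for every $x\in V$ there is $c_x>0$ with $|x|\wedge n|\varphi|\le c_x z$ for all $n\in\mathbb N$. Let $\Phi_1(V)$ be the set of finite elements (those that have a majorant), $\Phi_2(V)$ the set of totally finite elements (those that have a majorant which is itself finite), and $\Phi_3(V)=S_+(V)-S_+(V)$, where $S_+(V)$ is the set of positive self-majorizing elements (those $\varphi\ge 0$ that are a majorant of themselves). Let $p\ge 2$ be an integer and $\Pi_p(\mathcal A)=\{g_1\cdots g_p : g_1,\dots,g_p\in\mathcal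 A\}$. Then $\Pi_p(\mathcal A)$ is a subalgebra and a sublattice of $\mathcal A$, hence a vector lattice under the induced order and operations, and for $i=1,2,3$ \[ \{g_1\cdots g_p : g_1,\dots,g_p\in\Phi_i(\mathcal A)\}=\Phi_i\big(\Pi_p(\mathcal A)\big). \] -/

import Mathlib

section VectorLattice

/-- The Archimedean property of a vector lattice. (Mathlib's `Archimedean` is a different notion for
orders that are not total.) -/
def IsArchimedeanLattice (V : Type*) [AddCommGroup V] [Lattice V] : Prop :=
  ∀ x y : V, 0 ≤ x → (∀ n : ℕ, n • x ≤ y) → x = 0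

/-- Relatively uniform completeness: for every `u ≥ 0`, every `u`-uniform Cauchy sequence has a
`u`-uniform limit. -/
def IsUniformlyComplete (V : Type*) [AddCommGroup V] [Lattice V] [Module ℝ V] : Prop :=
  ∀ u : V, 0 ≤ u → ∀ f : ℕ → V,
    (∀ ε : ℝ, 0 < ε → ∃ N : ℕ, ∀ m ≥ N, ∀ n ≥ N, |f m - f n| ≤ ε • u) →
    ∃ g : V, ∀ ε : ℝ, 0 < ε → ∃ N : ℕ, ∀ n ≥ N, |f n - g| ≤ ε • u

/-- `z` is a majorant of `φ` in the vector lattice `V`. -/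
def IsMajorant {V : Type*} [AddCommGroup V] [Lattice V] [Module ℝ V] (z φ : V) : Prop :=
  0 ≤ z ∧ ∀ x : V, ∃ c : ℝ, 0 < c ∧ ∀ n : ℕ, |x| ⊓ n • |φ| ≤ c • z

/-- `Φ₁(V)`: the finite elements of `V`. -/
def finiteElements (V : Type*) [AddCommGroup V] [Lattice V] [Module ℝ V] : Set V :=
  {φ | ∃ z : V, IsMajorant z φ}

/-- `Φ₂(V)`: the totally finite elements of `V`. -/
def totallyFiniteElements (V : Type*) [AddCommGroup V] [Lattice V] [Module ℝ V] : Set V :=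
  {φ | ∃ z ∈ finiteElements V, IsMajorant z φ}

/-- `S₊(V)`: the positive self-majorizing elements of `V`. -/
def positiveSelfMajorizing (V : Type*) [AddCommGroup V] [Lattice V] [Module ℝ V] : Set V :=
  {φ | 0 ≤ φ ∧ IsMajorant |φ| φ}

/-- `Φ₃(V) = S₊(V) - S₊(V)`. -/
def selfMajorizingDifferences (V : Type*) [AddCommGroup V] [Lattice V] [Module ℝ V] : Set V :=
  {φ | ∃ s ∈ positiveSelfMajorizing V, ∃ t ∈ positiveSelfMajorizing V, φ = s - t}

end VectorLattice

section Products

/-- The product `g 0 * g 1 * ⋯ * g (p - 1)` in an algebra that need not have a unit. Only `p ≥ 1` is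
meaningful; the value at `p = 0` is a convention that is never used. -/
def foldProd {A : Type*} [NonUnitalRing A] : (p : ℕ) → (Fin p → A) → A
  | 0, _ => 0
  | 1, g => g 0
  | n + 2, g => foldProd (n + 1) (fun i => g i.castSucc) * g (Fin.last (n + 1))

/-- The set of all `p`-fold products of elements of `S`. -/
def foldProducts {A : Type*} [NonUnitalRing A] (p : ℕ) (S : Set A) : Set A :=
  {a | ∃ g : Fin p → A, (∀ i, g i ∈ S) ∧ foldProd p g = a}

/-- Zero is the only nilpotent element. -/
def IsSemiprimeAlgebra (A : Type*) [NonUnitalRing A] : Prop :=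
  ∀ a : A, (∃ n : ℕ, 1 ≤ n ∧ foldProd n (fun _ => a) = 0) → a = 0

end Products

section FAlgebra

/-- The conditions that make a vector lattice with an associative bilinear multiplication
an `f`-algebra. -/
structure IsFAlgebra (A : Type*) [NonUnitalRing A] [Lattice A] : Prop where
  mul_nonneg : ∀ a b : A, 0 ≤ a → 0 ≤ b → 0 ≤ a * b
  mul_right_disjoint : ∀ a b c : A, a ⊓ b = 0 → 0 ≤ c → (a * c) ⊓ b = 0
  mul_left_disjoint : ∀ a b c : A, a ⊓ b = 0 → 0 ≤ c → (c * a) ⊓ b = 0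

/-- A subalgebra that is also a sublattice, with the induced order and operations. -/
structure LatticeSubalgebra (A : Type*) [NonUnitalRing A] [Lattice A] [Module ℝ A]
    extends NonUnitalSubalgebra ℝ A where
  sup_mem' : ∀ {a b : A}, a ∈ carrier → b ∈ carrier → a ⊔ b ∈ carrier
  inf_mem' : ∀ {a b : A}, a ∈ carrier → b ∈ carrier → a ⊓ b ∈ carrier

/-- The lattice structure of a lattice subalgebra, for the order induced from `A`. -/
instance LatticeSubalgebra.instLattice {A : Type*} [NonUnitalRing A] [Lattice A] [Module ℝ A]
    (P : LatticeSubalgebra A) : Lattice P.toNonUnitalSubalgebra :=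
  Subtype.lattice (fun _ _ ha hb => P.sup_mem' ha hb) (fun _ _ ha hb => P.inf_mem' ha hb)

instance LatticeSubalgebra.instIsOrderedAddMonoid {A : Type*} [NonUnitalRing A] [Lattice A]
    [Module ℝ A] [IsOrderedAddMonoid A] (P : LatticeSubalgebra A) :
    IsOrderedAddMonoid P.toNonUnitalSubalgebra where
  add_le_add_left a b h c := add_le_add_left (show (a : A) ≤ b from h) (c : A)

instance LatticeSubalgebra.instPosSMulMono {A : Type*} [NonUnitalRing A] [Lattice A]
    [Module ℝ A] [PosSMulMono ℝ A] (P : LatticeSubalgebra A) :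
    PosSMulMono ℝ P.toNonUnitalSubalgebra where
  smul_le_smul_of_nonneg_left c hc a b h :=
    show c • (a : A) ≤ c • (b : A) from
      smul_le_smul_of_nonneg_left (show (a : A) ≤ b from h) hc

end FAlgebra

/-!
Let `e = |g₁| + ⋯ + |gₚ|`. Formally, every element obtained from the `gᵢ` by lattice operations is
`e * q (g / e)` for a continuous function `q` on the cube `[-1, 1]ᵖ`, its symbol. There is no unit
and no division, so this is read as an estimate: the element is close to `q t • e` wherever all
deviations `|gᵢ - tᵢ • e|` are small. By the Archimedean property the sum of these deviations has
infimum zero over `t`, so a symbol determines its element and order relations between symbols carry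
over. By uniform completeness and the lattice form of the Stone-Weierstrass theorem, every
continuous function is a symbol.

Hence `g₁ ⋯ gₚ`, which is formally `eᵖ * ∏ (gᵢ / e)`, equals `v * |v| ^ (p - 1)` for the element `v`
whose symbol is the signed `p`-th root of `∏ tᵢ`, and `|v| ≤ e`. So the `p`-fold products of
elements of a solid additive set are exactly the signed powers of its elements, and all `Φᵢ` are
such sets. If the algebra is semiprime, then `v ↦ v * |v| ^ (p - 1)` is an order isomorphism onto
its range. It is odd and positively homogeneous, and majorants are defined by scaling and lattice
operations alone, so it carries `Φᵢ` to `Φᵢ`.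
-/

open Set

section LatticeGroup

variable {V : Type*} [AddCommGroup V] [Lattice V] [IsOrderedAddMonoid V]

theorem inf_add_le {x a b : V} (hx : 0 ≤ x) (ha : 0 ≤ a) (hb : 0 ≤ b) :
    x ⊓ (a + b) ≤ x ⊓ a + x ⊓ b := by
  rw [add_inf, inf_add, inf_add]
  exact le_inf (le_inf (inf_le_left.trans (le_add_of_nonneg_right hx))
    (inf_le_left.trans (le_add_of_nonneg_left ha)))
    (le_inf (inf_le_left.trans (le_add_of_nonneg_right hb)) inf_le_right)

theorem eq_zero_of_abs_nonpos {x : V} (h : |x| ≤ 0) : x = 0 :=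
  le_antisymm ((le_abs_self x).trans h) (neg_nonpos.1 ((neg_le_abs x).trans h))

theorem sup_inf_abs_sub_le {e : V} (he : 0 ≤ e) (a : V) : (e ⊔ a) ⊓ |a - e| ≤ e ⊔ (a - e) := by
  let _ := AddCommGroup.toDistribLattice V
  have sup_le_add : e ⊔ a ≤ e + a⁺ :=
    sup_le (le_add_of_nonneg_right (posPart_nonneg a))
      ((le_posPart a).trans (le_add_of_nonneg_left he))
  have sub_le_add : e - a ≤ e + a⁻ := by
    rw [sub_eq_add_neg]; exact add_le_add_right (neg_le_negPart a) e
  rw [abs, inf_sup_left, neg_sub]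
  refine sup_le (inf_le_right.trans le_sup_right) (le_sup_of_le_left ?_)
  calc (e ⊔ a) ⊓ (e - a) ≤ (e + a⁺) ⊓ (e + a⁻) := inf_le_inf sup_le_add sub_le_add
    _ = e := by rw [← add_inf, posPart_inf_negPart_eq_zero, add_zero]

open scoped Pointwise in
theorem isGLB_range_sum {ι κ : Type*} [Fintype ι] {g : ι → κ → V} {b : ι → V}
    (h : ∀ i, IsGLB (range (g i)) (b i)) :
    IsGLB (range fun t : ι → κ => ∑ i, g i (t i)) (∑ i, b i) := by
  have range_eq : (range fun t : ι → κ => ∑ i, g i (t i)) = ∑ i, range (g i) := by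
    ext x
    rw [mem_fintype_sum]
    constructor
    · rintro ⟨t, rfl⟩
      exact ⟨fun i => g i (t i), fun i => mem_range_self _, rfl⟩
    · rintro ⟨y, hy, rfl⟩
      choose t ht using hy
      exact ⟨t, Finset.sum_congr rfl fun i _ => ht i⟩
  rw [range_eq]
  classical
  refine Finset.induction_on (motive := fun s => IsGLB (∑ i ∈ s, range (g i)) (∑ i ∈ s, b i))
    Finset.univ (by simp [← Set.singleton_zero]) fun i s hi ih => ?_
  rw [Finset.sum_insert hi, Finset.sum_insert hi]
  exact (h i).add ih

end LatticeGroup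

section VectorLattice

variable {V : Type*} [AddCommGroup V] [Lattice V] [Module ℝ V] [PosSMulMono ℝ V]

theorem smul_sup_of_pos {c : ℝ} (hc : 0 < c) (x y : V) : c • (x ⊔ y) = c • x ⊔ c • y :=
  (OrderIso.smulRight (β := V) hc).map_sup x y

theorem IsArchimedeanLattice.nonpos_of_forall_nsmul_le (harch : IsArchimedeanLattice V) {x y : V}
    (h : ∀ n : ℕ, n • x ≤ y) : x ≤ 0 := by
  have hy : 0 ≤ y := by simpa using h 0
  refine posPart_eq_zero.1 (harch x⁺ y (posPart_nonneg x) fun n => ?_)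
  rcases n.eq_zero_or_pos with rfl | hn
  · simpa using hy
  rw [← Nat.cast_smul_eq_nsmul ℝ, posPart_def, smul_sup_of_pos (Nat.cast_pos.2 hn), smul_zero,
    Nat.cast_smul_eq_nsmul]
  exact sup_le (h n) hy

theorem IsArchimedeanLattice.nonpos_of_forall_le_smul (harch : IsArchimedeanLattice V) {x y : V}
    (hy : 0 ≤ y) (h : ∀ ε : ℝ, 0 < ε → x ≤ ε • y) : x ≤ 0 := by
  refine harch.nonpos_of_forall_nsmul_le (y := y) fun n => ?_
  rcases n.eq_zero_or_pos with rfl | hn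
  · simpa using hy
  have hn : (0 : ℝ) < n := Nat.cast_pos.2 hn
  rw [← Nat.cast_smul_eq_nsmul ℝ, ← le_inv_smul_iff_of_pos hn]
  exact h _ (inv_pos.2 hn)

theorem abs_real_smul [IsOrderedAddMonoid V] (c : ℝ) (x : V) : |c • x| = |c| • |x| := by
  have of_pos {c : ℝ} (hc : 0 < c) : |c • x| = c • |x| := by
    rw [abs, abs, smul_sup_of_pos hc, smul_neg]
  rcases lt_trichotomy c 0 with hc | rfl | hc
  · rw [← abs_neg, ← neg_smul, of_pos (neg_pos.2 hc), abs_of_neg hc]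
  · simp
  · rw [of_pos hc, abs_of_pos hc]

end VectorLattice

section FiniteElements

variable {V : Type*} [AddCommGroup V] [Lattice V] [Module ℝ V] {y z z' φ ψ : V}

theorem mem_positiveSelfMajorizing [IsOrderedAddMonoid V] :
    φ ∈ positiveSelfMajorizing V ↔ IsMajorant φ φ :=
  ⟨fun ⟨h0, h⟩ => by rwa [abs_of_nonneg h0] at h, fun h => ⟨h.1, by rwa [abs_of_nonneg h.1]⟩⟩

namespace IsMajorant

theorem of_smul {c : ℝ} (h : IsMajorant (c • z) φ) (hc : 0 < c) (hz : 0 ≤ z) : IsMajorant z φ := by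
  refine ⟨hz, fun x => ?_⟩
  obtain ⟨d, hd, hx⟩ := h.2 x
  exact ⟨d * c, mul_pos hd hc, fun n => by rw [mul_smul]; exact hx n⟩

theorem mono_left [PosSMulMono ℝ V] (h : IsMajorant z φ) (hz : z ≤ z') : IsMajorant z' φ := by
  refine ⟨h.1.trans hz, fun x => ?_⟩
  obtain ⟨c, hc, hx⟩ := h.2 x
  exact ⟨c, hc, fun n => (hx n).trans (smul_le_smul_of_nonneg_left hz hc.le)⟩

variable [IsOrderedAddMonoid V]

theorem of_abs_le (h : IsMajorant z φ) (hψ : |ψ| ≤ |φ|) : IsMajorant z ψ := by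
  refine ⟨h.1, fun x => ?_⟩
  obtain ⟨c, hc, hx⟩ := h.2 x
  exact ⟨c, hc, fun n => (inf_le_inf_left _ (nsmul_le_nsmul_right hψ n)).trans (hx n)⟩

variable [PosSMulMono ℝ V]

theorem add (hφ : IsMajorant y φ) (hψ : IsMajorant z ψ) : IsMajorant (y + z) (φ + ψ) := by
  refine ⟨add_nonneg hφ.1 hψ.1, fun x => ?_⟩
  obtain ⟨c, hc, hcx⟩ := hφ.2 x
  obtain ⟨d, hd, hdx⟩ := hψ.2 x
  refine ⟨c + d, add_pos hc hd, fun n => ?_⟩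
  calc |x| ⊓ n • |φ + ψ| ≤ |x| ⊓ (n • |φ| + n • |ψ|) :=
        inf_le_inf_left _ <| nsmul_add |φ| |ψ| n ▸ nsmul_le_nsmul_right (abs_add_le _ _) n
    _ ≤ |x| ⊓ n • |φ| + |x| ⊓ n • |ψ| :=
        inf_add_le (abs_nonneg _) (nsmul_nonneg (abs_nonneg _) n) (nsmul_nonneg (abs_nonneg _) n)
    _ ≤ c • y + d • z := add_le_add (hcx n) (hdx n)
    _ ≤ (c + d) • y + (c + d) • z :=
        add_le_add (smul_le_smul_of_nonneg_right (le_add_of_nonneg_right hd.le) hφ.1)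
          (smul_le_smul_of_nonneg_right (le_add_of_nonneg_left hc.le) hψ.1)
    _ = (c + d) • (y + z) := (smul_add _ _ _).symm

end IsMajorant

variable [IsOrderedAddMonoid V]

theorem isSolid_finiteElements : LatticeOrderedAddCommGroup.IsSolid (finiteElements V) :=
  fun _ ⟨z, hz⟩ _ h => ⟨z, hz.of_abs_le h⟩

theorem isSolid_totallyFiniteElements :
    LatticeOrderedAddCommGroup.IsSolid (totallyFiniteElements V) :=
  fun _ ⟨z, hz, hzφ⟩ _ h => ⟨z, hz, hzφ.of_abs_le h⟩

variable [PosSMulMono ℝ V]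

theorem mem_selfMajorizingDifferences :
    φ ∈ selfMajorizingDifferences V ↔ ∃ s, IsMajorant s s ∧ |φ| ≤ s := by
  constructor
  · rintro ⟨s, hs, t, ht, rfl⟩
    rw [mem_positiveSelfMajorizing] at hs ht
    refine ⟨s + t, hs.add ht, ?_⟩
    simpa only [sub_eq_add_neg, abs_neg, abs_of_nonneg hs.1, abs_of_nonneg ht.1] using
      abs_add_le s (-t)
  · rintro ⟨s, hs, hφ⟩
    have add_mem {x : V} (hx : 0 ≤ x) (hxs : x ≤ s) : x + s ∈ positiveSelfMajorizing V := by
      rw [mem_positiveSelfMajorizing]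
      have hsx : IsMajorant s x := hs.of_abs_le (by rwa [abs_of_nonneg hx, abs_of_nonneg hs.1])
      have two_smul_majorant : IsMajorant ((2 : ℝ) • s) (x + s) := two_smul ℝ s ▸ hsx.add hs
      exact (two_smul_majorant.of_smul two_pos hs.1).mono_left (le_add_of_nonneg_left hx)
    have posPart_le : φ⁺ ≤ s := (sup_le (le_abs_self φ) (abs_nonneg φ)).trans hφ
    have negPart_le : φ⁻ ≤ s := (sup_le (neg_le_abs φ) (abs_nonneg φ)).trans hφ
    refine ⟨_, add_mem (posPart_nonneg φ) posPart_le,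
      _, add_mem (negPart_nonneg φ) negPart_le, ?_⟩
    rw [add_sub_add_right_eq_sub, posPart_sub_negPart]

theorem isSolid_selfMajorizingDifferences :
    LatticeOrderedAddCommGroup.IsSolid (selfMajorizingDifferences V) := by
  intro φ hφ ψ h
  rw [mem_selfMajorizingDifferences] at hφ ⊢
  obtain ⟨s, hs, hφs⟩ := hφ
  exact ⟨s, hs, h.trans hφs⟩

theorem add_mem_finiteElements (hφ : φ ∈ finiteElements V) (hψ : ψ ∈ finiteElements V) :
    φ + ψ ∈ finiteElements V := by
  obtain ⟨y, hy⟩ := hφ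
  obtain ⟨z, hz⟩ := hψ
  exact ⟨y + z, hy.add hz⟩

theorem add_mem_totallyFiniteElements (hφ : φ ∈ totallyFiniteElements V)
    (hψ : ψ ∈ totallyFiniteElements V) : φ + ψ ∈ totallyFiniteElements V := by
  obtain ⟨y, hy, hyφ⟩ := hφ
  obtain ⟨z, hz, hzψ⟩ := hψ
  exact ⟨y + z, add_mem_finiteElements hy hz, hyφ.add hzψ⟩

theorem add_mem_selfMajorizingDifferences (hφ : φ ∈ selfMajorizingDifferences V)
    (hψ : ψ ∈ selfMajorizingDifferences V) : φ + ψ ∈ selfMajorizingDifferences V := by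
  rw [mem_selfMajorizingDifferences] at hφ hψ ⊢
  obtain ⟨s, hs, hφs⟩ := hφ
  obtain ⟨t, ht, hψt⟩ := hψ
  exact ⟨s + t, hs.add ht, (abs_add_le _ _).trans (add_le_add hφs hψt)⟩

end FiniteElements

section HomogeneousOrderIso

variable {V W : Type*} [AddCommGroup V] [Lattice V] [Module ℝ V]
  [AddCommGroup W] [Lattice W] [Module ℝ W]

/-- An order isomorphism, not assumed additive, which is odd and positively homogeneous of degree
`r > 0`. It preserves everything about majorants, whose definition involves no sums. -/
structure IsHomogeneousOrderIso (F : V ≃o W) (r : ℝ) : Prop where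
  degree_pos : 0 < r
  map_neg : ∀ v, F (-v) = -F v
  map_smul : ∀ (c : ℝ) (v : V), 0 < c → F (c • v) = c ^ r • F v

namespace IsHomogeneousOrderIso

variable {F : V ≃o W} {r : ℝ} {z φ : V}

theorem symm (hF : IsHomogeneousOrderIso F r) : IsHomogeneousOrderIso F.symm r⁻¹ where
  degree_pos := inv_pos.2 hF.degree_pos
  map_neg w := by rw [F.symm_apply_eq, hF.map_neg, F.apply_symm_apply]
  map_smul c w hc := by
    rw [F.symm_apply_eq, hF.map_smul _ _ (Real.rpow_pos_of_pos hc _), F.apply_symm_apply,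
      Real.rpow_inv_rpow hc.le hF.degree_pos.ne']

theorem map_abs (hF : IsHomogeneousOrderIso F r) (v : V) : F |v| = |F v| := by
  rw [abs, abs, F.map_sup, hF.map_neg]

variable [IsOrderedAddMonoid V] [IsOrderedAddMonoid W]

theorem map_nonneg (hF : IsHomogeneousOrderIso F r) (hz : 0 ≤ z) : 0 ≤ F z := by
  rw [← abs_of_nonneg hz, hF.map_abs]
  exact abs_nonneg _

variable [PosSMulMono ℝ W]

theorem map_isMajorant (hF : IsHomogeneousOrderIso F r) (h : IsMajorant z φ) :
    IsMajorant (F z) (F φ) := by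
  refine ⟨hF.map_nonneg h.1, fun x => ?_⟩
  obtain ⟨c, hc, hcz⟩ := h.2 (F.symm x)
  refine ⟨c ^ r, Real.rpow_pos_of_pos hc r, fun n => ?_⟩
  obtain ⟨m, hm, hnm⟩ : ∃ m : ℕ, 0 < m ∧ (n : ℝ) ≤ (m : ℝ) ^ r := by
    have large := (tendsto_rpow_atTop hF.degree_pos).comp tendsto_natCast_atTop_atTop
    exact ((Filter.eventually_gt_atTop 0).and (large.eventually_ge_atTop (n : ℝ))).exists
  have nsmul_le : n • |F φ| ≤ F (m • |φ|) := by
    rw [← Nat.cast_smul_eq_nsmul ℝ, ← Nat.cast_smul_eq_nsmul ℝ,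
      hF.map_smul _ _ (Nat.cast_pos.2 hm), hF.map_abs]
    exact smul_le_smul_of_nonneg_right hnm (abs_nonneg _)
  calc |x| ⊓ n • |F φ| ≤ F |F.symm x| ⊓ F (m • |φ|) := by
        rw [hF.map_abs, F.apply_symm_apply]
        exact inf_le_inf_left _ nsmul_le
    _ = F (|F.symm x| ⊓ m • |φ|) := (F.map_inf _ _).symm
    _ ≤ F (c • z) := F.monotone (hcz m)
    _ = c ^ r • F z := hF.map_smul c z hc

theorem map_mem_finiteElements (hF : IsHomogeneousOrderIso F r) (h : φ ∈ finiteElements V) :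
    F φ ∈ finiteElements W :=
  let ⟨_, hz⟩ := h
  ⟨_, hF.map_isMajorant hz⟩

theorem map_mem_totallyFiniteElements (hF : IsHomogeneousOrderIso F r)
    (h : φ ∈ totallyFiniteElements V) : F φ ∈ totallyFiniteElements W :=
  let ⟨_, hz, hzφ⟩ := h
  ⟨_, hF.map_mem_finiteElements hz, hF.map_isMajorant hzφ⟩

variable [PosSMulMono ℝ V]

theorem map_mem_selfMajorizingDifferences (hF : IsHomogeneousOrderIso F r)
    (h : φ ∈ selfMajorizingDifferences V) : F φ ∈ selfMajorizingDifferences W := by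
  rw [mem_selfMajorizingDifferences] at h ⊢
  obtain ⟨s, hs, hφs⟩ := h
  exact ⟨F s, hF.map_isMajorant hs, hF.map_abs φ ▸ F.monotone hφs⟩

theorem image_finiteElements (hF : IsHomogeneousOrderIso F r) :
    F '' finiteElements V = finiteElements W :=
  Subset.antisymm (image_subset_iff.2 fun _ => hF.map_mem_finiteElements) fun w hw =>
    ⟨F.symm w, hF.symm.map_mem_finiteElements hw, F.apply_symm_apply w⟩

theorem image_totallyFiniteElements (hF : IsHomogeneousOrderIso F r) :
    F '' totallyFiniteElements V = totallyFiniteElements W :=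
  Subset.antisymm (image_subset_iff.2 fun _ => hF.map_mem_totallyFiniteElements) fun w hw =>
    ⟨F.symm w, hF.symm.map_mem_totallyFiniteElements hw, F.apply_symm_apply w⟩

theorem image_selfMajorizingDifferences (hF : IsHomogeneousOrderIso F r) :
    F '' selfMajorizingDifferences V = selfMajorizingDifferences W :=
  Subset.antisymm (image_subset_iff.2 fun _ => hF.map_mem_selfMajorizingDifferences) fun w hw =>
    ⟨F.symm w, hF.symm.map_mem_selfMajorizingDifferences hw, F.apply_symm_apply w⟩

end IsHomogeneousOrderIso

end HomogeneousOrderIso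

section Orthomorphism

variable {V : Type*} [AddCommGroup V] [Lattice V] [Module ℝ V]

/-- Positive orthomorphisms: linear operators mapping every element disjoint from `b` to an element
disjoint from `b`. Multiplications by positive elements of an `f`-algebra are the main example. -/
def IsPosOrthomorphism (T : Module.End ℝ V) : Prop :=
  ∀ a b : V, a ⊓ b = 0 → T a ⊓ b = 0

namespace IsPosOrthomorphism

theorem one : IsPosOrthomorphism (1 : Module.End ℝ V) := fun _ _ h => h

variable {S T : Module.End ℝ V}

theorem mul (hS : IsPosOrthomorphism S) (hT : IsPosOrthomorphism T) :
    IsPosOrthomorphism (S * T) :=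
  fun a b h => hS (T a) b (hT a b h)

theorem pow (hT : IsPosOrthomorphism T) (n : ℕ) : IsPosOrthomorphism (T ^ n) := by
  induction n with
  | zero => exact one
  | succ n ih => rw [pow_succ]; exact ih.mul hT

theorem map_nonneg (hT : IsPosOrthomorphism T) {a : V} (ha : 0 ≤ a) : 0 ≤ T a :=
  inf_eq_right.1 (hT a 0 (inf_eq_right.2 ha))

variable [IsOrderedAddMonoid V]

theorem add (hS : IsPosOrthomorphism S) (hT : IsPosOrthomorphism T) :
    IsPosOrthomorphism (S + T) := fun a b h => by
  have ha : 0 ≤ a := h ▸ inf_le_left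
  have hb : 0 ≤ b := h ▸ inf_le_right
  refine le_antisymm ?_ (le_inf (add_nonneg (hS.map_nonneg ha) (hT.map_nonneg ha)) hb)
  calc (S + T) a ⊓ b = b ⊓ (S a + T a) := inf_comm _ _
    _ ≤ b ⊓ S a + b ⊓ T a := inf_add_le hb (hS.map_nonneg ha) (hT.map_nonneg ha)
    _ = 0 := by rw [inf_comm b, hS a b h, inf_comm b, hT a b h, add_zero]

theorem monotone (hT : IsPosOrthomorphism T) : Monotone T := fun a b h => by
  rw [← sub_nonneg, ← map_sub]
  exact hT.map_nonneg (sub_nonneg.2 h)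

theorem abs_map_le (hT : IsPosOrthomorphism T) (a : V) : |T a| ≤ T |a| :=
  abs_le'.2 ⟨hT.monotone (le_abs_self a), by
    rw [← map_neg]; exact hT.monotone (neg_le_abs a)⟩

theorem map_inf (hT : IsPosOrthomorphism T) (a b : V) : T (a ⊓ b) = T a ⊓ T b := by
  have disjoint_sub : (a - a ⊓ b) ⊓ (b - a ⊓ b) = 0 := by rw [← inf_sub, sub_self]
  have disjoint_map : T (a - a ⊓ b) ⊓ T (b - a ⊓ b) = 0 := by
    rw [inf_comm]
    exact hT _ _ (by rw [inf_comm]; exact hT _ _ disjoint_sub)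
  rw [map_sub, map_sub, ← inf_sub, sub_eq_zero] at disjoint_map
  exact disjoint_map.symm

theorem le_map_of_forall_le_map_abs_sub_nsmul (hT : IsPosOrthomorphism T) {e g x : V} (he : 0 ≤ e)
    (hg : 0 ≤ g) {N : ℕ} (hgN : g ≤ N • e) (hx : ∀ k ≤ N, x ≤ T |g - k • e|) : x ≤ T e := by
  have le_map_sup : ∀ k ≤ N, x ≤ T (e ⊔ (g - k • e)) := by
    intro k
    induction k with
    | zero =>
      intro hk
      refine (hx 0 hk).trans (hT.monotone ?_)
      simp [abs_of_nonneg hg]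
    | succ k ih =>
      intro hk
      have hsucc : g - (k + 1) • e = g - k • e - e := by rw [succ_nsmul, sub_sub]
      refine (le_inf (ih (Nat.le_of_succ_le hk)) (hx _ hk)).trans ?_
      rw [← hT.map_inf, hsucc]
      exact hT.monotone (sup_inf_abs_sub_le he _)
  have sup_eq : e ⊔ (g - N • e) = e := sup_eq_left.2 ((sub_nonpos.2 hgN).trans he)
  simpa only [sup_eq] using le_map_sup N le_rfl

variable [PosSMulMono ℝ V]

/- The `2 N + 1` elements `N • (f - s • e)` with `s ∈ N⁻¹ ℤ ∩ [-1, 1]` form an arithmetic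
progression with difference `e` that changes sign, so any lower bound `x` satisfies
`N • x ≤ T e`. -/
theorem isGLB_map_abs_sub_smul (hT : IsPosOrthomorphism T) (harch : IsArchimedeanLattice V)
    {e f : V} (hf : |f| ≤ e) :
    IsGLB (range fun s : Icc (-1 : ℝ) 1 => T |f - (s : ℝ) • e|) 0 := by
  have he : 0 ≤ e := (abs_nonneg f).trans hf
  have ⟨hfe, hef⟩ := abs_le'.1 hf
  refine ⟨?_, fun x hx => harch.nonpos_of_forall_nsmul_le (y := T e) fun N => ?_⟩
  · rintro _ ⟨s, rfl⟩
    exact hT.map_nonneg (abs_nonneg _)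
  rcases N.eq_zero_or_pos with rfl | hN
  · rw [zero_nsmul]; exact hT.map_nonneg he
  have hN' : (0 : ℝ) < N := Nat.cast_pos.2 hN
  refine hT.le_map_of_forall_le_map_abs_sub_nsmul (g := N • (f + e)) (N := 2 * N) he
    (nsmul_nonneg (neg_le_iff_add_nonneg'.1 hef) N) ?_ fun k hk => ?_
  · rw [mul_comm, mul_nsmul', two_nsmul]
    exact nsmul_le_nsmul_right (add_le_add_left hfe e) N
  have hk' : (k : ℝ) ≤ 2 * N := by exact_mod_cast hk
  have hs : (k / N - 1 : ℝ) ∈ Icc (-1 : ℝ) 1 :=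
    ⟨by linarith [div_nonneg k.cast_nonneg hN'.le],
      by linarith [(div_le_iff₀ hN').2 hk']⟩
  have grid_eq : N • (f + e) - k • e = (N : ℝ) • (f - (k / N - 1 : ℝ) • e) := by
    simp only [← Nat.cast_smul_eq_nsmul ℝ]
    match_scalars <;> field_simp
    ring
  rw [grid_eq, abs_real_smul, abs_of_pos hN', map_smul, Nat.cast_smul_eq_nsmul]
  exact nsmul_le_nsmul_right (hx ⟨⟨_, hs⟩, rfl⟩) N

end IsPosOrthomorphism

end Orthomorphism

section Deviation

/-- The cube `[-1, 1]^ι`, on which the symbols of the functional calculus live. -/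
abbrev Cube (ι : Type*) : Type _ := ι → Icc (-1 : ℝ) 1

/-- The `i`-th coordinate function on the cube, the symbol of the `i`-th member of a family. -/
def cubeCoord {ι : Type*} (i : ι) : C(Cube ι, ℝ) := ⟨fun t => t i, by fun_prop⟩

@[simp]
theorem cubeCoord_apply {ι : Type*} (i : ι) (t : Cube ι) : cubeCoord i t = t i := rfl

variable {V ι : Type*} [AddCommGroup V] [Lattice V] [Module ℝ V] [Fintype ι]

/-- The deviation `∑ |fᵢ - tᵢ e|` of the family `f` from the multiples `tᵢ e`: the abstract
counterpart of the distance between `f / e` and the point `t`. -/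
def deviation (e : V) (f : ι → V) (t : Cube ι) : V :=
  ∑ i, |f i - (t i : ℝ) • e|

variable [IsOrderedAddMonoid V] {T : Module.End ℝ V} {e : V} {f : ι → V}

theorem abs_sub_smul_le_deviation (e : V) (f : ι → V) (t : Cube ι) (i : ι) :
    |f i - (t i : ℝ) • e| ≤ deviation e f t :=
  Finset.single_le_sum (f := fun i => |f i - (t i : ℝ) • e|) (fun _ _ => abs_nonneg _)
    (Finset.mem_univ i)

theorem deviation_nonneg (e : V) (f : ι → V) (t : Cube ι) : 0 ≤ deviation e f t :=
  Finset.sum_nonneg fun _ _ => abs_nonneg _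

variable [PosSMulMono ℝ V]

theorem IsPosOrthomorphism.isGLB_map_deviation (hT : IsPosOrthomorphism T)
    (harch : IsArchimedeanLattice V) (hf : ∀ i, |f i| ≤ e) :
    IsGLB (range fun t => T (deviation e f t)) 0 := by
  have := isGLB_range_sum fun i => hT.isGLB_map_abs_sub_smul harch (hf i)
  simpa only [deviation, Finset.sum_const_zero, map_sum] using this

theorem IsPosOrthomorphism.le_of_forall_le_add_smul_map_deviation (hT : IsPosOrthomorphism T)
    (harch : IsArchimedeanLattice V) (hf : ∀ i, |f i| ≤ e) {x y : V} {C : ℝ} (hC : 0 ≤ C)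
    (h : ∀ t, x ≤ y + C • T (deviation e f t)) : x ≤ y := by
  have hC' : 0 < C + 1 := by linarith
  have lower_bound : (C + 1)⁻¹ • (x - y) ∈ lowerBounds (range fun t => T (deviation e f t)) := by
    rintro _ ⟨t, rfl⟩
    rw [inv_smul_le_iff_of_pos hC', sub_le_iff_le_add', add_smul, one_smul, ← add_assoc]
    exact (h t).trans (le_add_of_nonneg_right (hT.map_nonneg (deviation_nonneg e f t)))
  have := (hT.isGLB_map_deviation harch hf).2 lower_bound
  rwa [inv_smul_le_iff_of_pos hC', smul_zero, sub_nonpos] at this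

end Deviation

namespace IsFAlgebra

variable {A : Type*} [NonUnitalRing A] [Lattice A]

theorem isPosOrthomorphism_mulRight [Module ℝ A] [IsScalarTower ℝ A A] (hA : IsFAlgebra A) {c : A}
    (hc : 0 ≤ c) : IsPosOrthomorphism (LinearMap.mulRight ℝ c) :=
  fun a b h => hA.mul_right_disjoint a b c h hc

theorem isPosOrthomorphism_mulLeft [Module ℝ A] [SMulCommClass ℝ A A] (hA : IsFAlgebra A) {c : A}
    (hc : 0 ≤ c) : IsPosOrthomorphism (LinearMap.mulLeft ℝ c) :=
  fun a b h => hA.mul_left_disjoint a b c h hc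

variable [IsOrderedAddMonoid A] [Module ℝ A] [SMulCommClass ℝ A A]

theorem abs_mul_le (hA : IsFAlgebra A) (a b : A) : |a * b| ≤ |a| * |b| := by
  have mul_abs_le {c : A} (hc : 0 ≤ c) : |c * b| ≤ c * |b| :=
    (hA.isPosOrthomorphism_mulLeft hc).abs_map_le b
  calc |a * b| = |a⁺ * b + -(a⁻ * b)| := by
        rw [← sub_eq_add_neg, ← sub_mul, posPart_sub_negPart]
    _ ≤ |a⁺ * b| + |a⁻ * b| := (abs_add_le _ _).trans_eq (by rw [abs_neg])
    _ ≤ a⁺ * |b| + a⁻ * |b| :=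
        add_le_add (mul_abs_le (posPart_nonneg a)) (mul_abs_le (negPart_nonneg a))
    _ = |a| * |b| := by rw [← add_mul, posPart_add_negPart]

variable [PosSMulMono ℝ A] [IsScalarTower ℝ A A]

/- The commutator with `e` kills the multiples of `e`, and `T = e * · + · * e` dominates it. -/
theorem commute_of_abs_le (hA : IsFAlgebra A) (harch : IsArchimedeanLattice A) {e f : A}
    (hf : |f| ≤ e) : Commute f e := by
  have he : 0 ≤ e := (abs_nonneg f).trans hf
  have hL := hA.isPosOrthomorphism_mulLeft he
  have hR := hA.isPosOrthomorphism_mulRight he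
  have commutator_le : |f * e - e * f| ∈ lowerBounds (range fun s : Icc (-1 : ℝ) 1 =>
      (LinearMap.mulLeft ℝ e + LinearMap.mulRight ℝ e) |f - (s : ℝ) • e|) := by
    rintro _ ⟨s, rfl⟩
    set g := f - (s : ℝ) • e with hg
    have commutator_eq : f * e - e * f = g * e - e * g := by
      simp only [hg, sub_mul, mul_sub, smul_mul_assoc, mul_smul_comm]; abel
    calc |f * e - e * f| = |-(e * g) + g * e| := by rw [commutator_eq]; congr 1; abel
      _ ≤ |e * g| + |g * e| := (abs_add_le _ _).trans_eq (by rw [abs_neg])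
      _ ≤ e * |g| + |g| * e := add_le_add (hL.abs_map_le g) (hR.abs_map_le g)
  have := ((hL.add hR).isGLB_map_abs_sub_smul harch hf).2 commutator_le
  exact sub_eq_zero.1 (eq_zero_of_abs_nonpos this)

theorem commute (hA : IsFAlgebra A) (harch : IsArchimedeanLattice A) (a b : A) : Commute a b := by
  have commute_of_nonneg {a b : A} (ha : 0 ≤ a) (hb : 0 ≤ b) : Commute a b := by
    have := hA.commute_of_abs_le harch (f := a) (e := a + b)
      (by rw [abs_of_nonneg ha]; exact le_add_of_nonneg_right hb)
    simpa using this.sub_right (Commute.refl a)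
  have commute_nonneg_left {a : A} (ha : 0 ≤ a) : Commute a b := by
    rw [← posPart_sub_negPart b]
    exact (commute_of_nonneg ha (posPart_nonneg b)).sub_right
      (commute_of_nonneg ha (negPart_nonneg b))
  rw [← posPart_sub_negPart a]
  exact (commute_nonneg_left (posPart_nonneg a)).sub_left (commute_nonneg_left (negPart_nonneg a))

end IsFAlgebra

section AbsSum

variable {V ι : Type*} [AddCommGroup V] [Lattice V] [Fintype ι]

/-- The sum of the moduli of `f`, the canonical unit of the ideal generated by the family `f`. -/
def absSum (f : ι → V) : V := ∑ i, |f i|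

variable [IsOrderedAddMonoid V]

theorem absSum_nonneg (f : ι → V) : 0 ≤ absSum f :=
  Finset.sum_nonneg fun _ _ => abs_nonneg _

theorem abs_le_absSum (f : ι → V) (i : ι) : |f i| ≤ absSum f :=
  Finset.single_le_sum (f := fun i => |f i|) (fun _ _ => abs_nonneg _) (Finset.mem_univ i)

end AbsSum

section Symbol

variable {V ι : Type*} [AddCommGroup V] [Lattice V] [Module ℝ V] [Fintype ι]

/-- `r` is negligible if `r t` is small, relative to the unit `T (absSum f)`, wherever `f` is close
to `t • absSum f`: the abstract form of `r t = o(1)` as `t → f / absSum f`. -/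
def IsNegligible (T : Module.End ℝ V) (f : ι → V) (r : Cube ι → V) : Prop :=
  ∀ ε : ℝ, 0 < ε → ∃ C : ℝ, 0 ≤ C ∧
    ∀ t, |r t| ≤ ε • T (absSum f) + C • T (deviation (absSum f) f t)

/-- `y` has symbol `q` with respect to `f` and `T`: the abstract form of `y = T (e * q (f / e))` for
`e = absSum f`, which makes sense without a unit and without dividing by `e`. -/
def HasSymbol (T : Module.End ℝ V) (f : ι → V) (y : V) (q : C(Cube ι, ℝ)) : Prop :=
  IsNegligible T f fun t => y - q t • T (absSum f)

variable [IsOrderedAddMonoid V]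

namespace IsNegligible

variable {S T : Module.End ℝ V} {f : ι → V} {r s : Cube ι → V}

theorem add (hr : IsNegligible T f r) (hs : IsNegligible T f s) :
    IsNegligible T f fun t => r t + s t := by
  intro ε hε
  obtain ⟨C, hC, hrC⟩ := hr (ε / 2) (half_pos hε)
  obtain ⟨D, hD, hsD⟩ := hs (ε / 2) (half_pos hε)
  refine ⟨C + D, add_nonneg hC hD, fun t => (abs_add_le _ _).trans ?_⟩
  refine (add_le_add (hrC t) (hsD t)).trans_eq ?_
  module

theorem of_forall_approx
    (h : ∀ ε : ℝ, 0 < ε → ∃ s, IsNegligible T f s ∧ ∀ t, |r t - s t| ≤ ε • T (absSum f)) :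
    IsNegligible T f r := by
  intro ε hε
  obtain ⟨s, hs, hrs⟩ := h (ε / 2) (half_pos hε)
  obtain ⟨C, hC, hsC⟩ := hs (ε / 2) (half_pos hε)
  refine ⟨C, hC, fun t => ?_⟩
  calc |r t| = |r t - s t + s t| := by rw [sub_add_cancel]
    _ ≤ |r t - s t| + |s t| := abs_add_le _ _
    _ ≤ _ := add_le_add (hrs t) (hsC t)
    _ = _ := by module

theorem map (hr : IsNegligible T f r) (hS : IsPosOrthomorphism S) :
    IsNegligible (S * T) f fun t => S (r t) := by
  intro ε hε
  obtain ⟨C, hC, hrC⟩ := hr ε hε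
  refine ⟨C, hC, fun t => (hS.abs_map_le _).trans ((hS.monotone (hrC t)).trans_eq ?_)⟩
  simp only [map_add, map_smul, Module.End.mul_apply]

variable [PosSMulMono ℝ V]

theorem of_abs_le (hr : IsNegligible T f r) (c : ℝ) (h : ∀ t, |s t| ≤ c • |r t|) :
    IsNegligible T f s := by
  intro ε hε
  have hc : 0 < |c| + 1 := by positivity
  obtain ⟨C, hC, hrC⟩ := hr (ε / (|c| + 1)) (div_pos hε hc)
  refine ⟨(|c| + 1) * C, by positivity, fun t => ?_⟩
  have le_bound : c • |r t| ≤ (|c| + 1) • |r t| :=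
    smul_le_smul_of_nonneg_right (by linarith [le_abs_self c]) (abs_nonneg _)
  calc |s t| ≤ (|c| + 1) • |r t| := (h t).trans le_bound
    _ ≤ (|c| + 1) • ((ε / (|c| + 1)) • T (absSum f) + C • T (deviation (absSum f) f t)) :=
        smul_le_smul_of_nonneg_left (hrC t) hc.le
    _ = _ := by rw [smul_add, smul_smul, smul_smul, mul_div_cancel₀ _ hc.ne']

theorem abs (hr : IsNegligible T f r) : IsNegligible T f fun t => |r t| :=
  hr.of_abs_le 1 fun t => by rw [one_smul, abs_abs]

end IsNegligible

namespace HasSymbol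

variable {S T : Module.End ℝ V} {f : ι → V} {y y' : V} {q q' : C(Cube ι, ℝ)}

theorem add (hy : HasSymbol T f y q) (hy' : HasSymbol T f y' q') :
    HasSymbol T f (y + y') (q + q') := by
  have := IsNegligible.add hy hy'
  simpa only [HasSymbol, ContinuousMap.add_apply, add_smul, add_sub_add_comm] using this

theorem map (hy : HasSymbol T f y q) (hS : IsPosOrthomorphism S) :
    HasSymbol (S * T) f (S y) q := by
  simpa only [HasSymbol, map_sub, map_smul, Module.End.mul_apply] using IsNegligible.map hy hS

variable [PosSMulMono ℝ V]

theorem unit (hT : IsPosOrthomorphism T) (f : ι → V) : HasSymbol T f (T (absSum f)) 1 := by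
  intro ε hε
  refine ⟨0, le_rfl, fun t => ?_⟩
  simpa using smul_nonneg hε.le (hT.map_nonneg (absSum_nonneg f))

theorem generator (f : ι → V) (i : ι) :
    HasSymbol 1 f (f i) (cubeCoord i) := by
  intro ε hε
  refine ⟨1, zero_le_one, fun t => ?_⟩
  rw [one_smul]
  exact (abs_sub_smul_le_deviation _ f t i).trans
    (le_add_of_nonneg_left (smul_nonneg hε.le (absSum_nonneg f)))

theorem smul (hy : HasSymbol T f y q) (c : ℝ) : HasSymbol T f (c • y) (c • q) :=
  IsNegligible.of_abs_le hy |c| fun t => by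
    rw [← abs_real_smul, smul_sub, ContinuousMap.smul_apply, smul_assoc]

theorem sub (hy : HasSymbol T f y q) (hy' : HasSymbol T f y' q') :
    HasSymbol T f (y - y') (q - q') := by
  simpa only [sub_eq_add_neg, neg_one_smul] using hy.add (hy'.smul (-1))

theorem abs (hy : HasSymbol T f y q) (hT : IsPosOrthomorphism T) : HasSymbol T f |y| |q| :=
  IsNegligible.of_abs_le hy 1 fun t => by
    have abs_eq : |q t • T (absSum f)| = |q| t • T (absSum f) := by
      rw [abs_real_smul, abs_of_nonneg (hT.map_nonneg (absSum_nonneg f)), ContinuousMap.abs_apply]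
    rw [one_smul, ← abs_eq]
    exact abs_abs_sub_abs_le _ _

theorem sup (hy : HasSymbol T f y q) (hy' : HasSymbol T f y' q') (hT : IsPosOrthomorphism T) :
    HasSymbol T f (y ⊔ y') (q ⊔ q') := by
  have := ((hy.add hy').add ((hy'.sub hy).abs hT)).smul 2⁻¹
  rwa [← sup_eq_half_smul_add_add_abs_sub', ← sup_eq_half_smul_add_add_abs_sub'] at this

theorem inf (hy : HasSymbol T f y q) (hy' : HasSymbol T f y' q') (hT : IsPosOrthomorphism T) :
    HasSymbol T f (y ⊓ y') (q ⊓ q') := by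
  have := ((hy.add hy').sub ((hy'.sub hy).abs hT)).smul 2⁻¹
  rwa [← inf_eq_half_smul_add_sub_abs_sub', ← inf_eq_half_smul_add_sub_abs_sub'] at this

theorem mono (hy : HasSymbol T f y q) (hy' : HasSymbol T f y' q') (hT : IsPosOrthomorphism T)
    (harch : IsArchimedeanLattice V) (hq : q ≤ q') : y ≤ y' := by
  have hTe : 0 ≤ T (absSum f) := hT.map_nonneg (absSum_nonneg f)
  rw [← sub_nonpos]
  refine harch.nonpos_of_forall_le_smul hTe fun ε hε => ?_
  obtain ⟨C, hC, h⟩ := hy.sub hy' ε hε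
  refine hT.le_of_forall_le_add_smul_map_deviation harch (abs_le_absSum f) hC fun t => ?_
  refine le_trans ?_ ((le_abs_self _).trans (h t))
  rw [le_sub_self_iff]
  exact smul_nonpos_of_nonpos_of_nonneg (sub_nonpos.2 (hq t)) hTe

theorem ext (hy : HasSymbol T f y q) (hy' : HasSymbol T f y' q) (hT : IsPosOrthomorphism T)
    (harch : IsArchimedeanLattice V) : y = y' :=
  (hy.mono hy' hT harch le_rfl).antisymm (hy'.mono hy hT harch le_rfl)

theorem abs_le_norm_smul (hy : HasSymbol T f y q) (hT : IsPosOrthomorphism T)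
    (harch : IsArchimedeanLattice V) : |y| ≤ ‖q‖ • T (absSum f) :=
  (hy.abs hT).mono ((unit hT f).smul ‖q‖) hT harch fun t => by
    simpa using q.norm_coe_le_norm t

theorem of_forall_approx (hT : IsPosOrthomorphism T)
    (h : ∀ ε : ℝ, 0 < ε → ∃ y' q', HasSymbol T f y' q' ∧
      |y - y'| ≤ ε • T (absSum f) ∧ ‖q - q'‖ ≤ ε) : HasSymbol T f y q := by
  refine IsNegligible.of_forall_approx fun ε hε => ?_
  obtain ⟨y', q', hy', hyy', hqq'⟩ := h (ε / 2) (half_pos hε)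
  refine ⟨_, hy', fun t => ?_⟩
  have hTe : 0 ≤ T (absSum f) := hT.map_nonneg (absSum_nonneg f)
  have symbol_le : |(q - q') t • T (absSum f)| ≤ (ε / 2) • T (absSum f) := by
    rw [abs_real_smul, abs_of_nonneg hTe]
    exact smul_le_smul_of_nonneg_right (((q - q').norm_coe_le_norm t).trans hqq') hTe
  calc |y - q t • T (absSum f) - (y' - q' t • T (absSum f))|
      = |(y - y') + -((q - q') t • T (absSum f))| := by
        rw [ContinuousMap.sub_apply, sub_smul]; congr 1; abel
    _ ≤ |y - y'| + |(q - q') t • T (absSum f)| := (abs_add_le _ _).trans_eq (by rw [abs_neg])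
    _ ≤ (ε / 2) • T (absSum f) + (ε / 2) • T (absSum f) := add_le_add hyy' symbol_le
    _ = ε • T (absSum f) := by module

end HasSymbol

variable [PosSMulMono ℝ V]

theorem isClosed_setOf_exists_hasSymbol (hT : IsPosOrthomorphism T)
    (harch : IsArchimedeanLattice V) (hcomplete : IsUniformlyComplete V) (f : ι → V) :
    IsClosed {q : C(Cube ι, ℝ) | ∃ y, HasSymbol T f y q} := by
  refine isClosed_of_closure_subset fun q hq => ?_
  obtain ⟨Q, hQ, hlim⟩ := mem_closure_iff_seq_limit.1 hq
  choose Y hY using hQ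
  have hTe : 0 ≤ T (absSum f) := hT.map_nonneg (absSum_nonneg f)
  have cauchy : ∀ ε : ℝ, 0 < ε → ∃ N, ∀ m ≥ N, ∀ n ≥ N, |Y m - Y n| ≤ ε • T (absSum f) := by
    intro ε hε
    obtain ⟨N, hN⟩ := Metric.cauchySeq_iff.1 hlim.cauchySeq ε hε
    refine ⟨N, fun m hm n hn => (((hY m).sub (hY n)).abs_le_norm_smul hT harch).trans ?_⟩
    rw [← dist_eq_norm]
    exact smul_le_smul_of_nonneg_right (hN m hm n hn).le hTe
  obtain ⟨y, hy⟩ := hcomplete _ hTe Y cauchy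
  refine ⟨y, .of_forall_approx hT fun ε hε => ?_⟩
  obtain ⟨M, hM⟩ := hy ε hε
  obtain ⟨N, hN⟩ := Metric.tendsto_atTop.1 hlim ε hε
  refine ⟨_, _, hY (max M N), ?_, ?_⟩
  · rw [abs_sub_comm]; exact hM _ (le_max_left M N)
  · rw [← dist_eq_norm, dist_comm]; exact (hN _ (le_max_right M N)).le

theorem exists_hasSymbol (harch : IsArchimedeanLattice V) (hcomplete : IsUniformlyComplete V)
    (f : ι → V) (q : C(Cube ι, ℝ)) : ∃ y, HasSymbol 1 f y q := by
  let L : Set C(Cube ι, ℝ) := {q | ∃ y, HasSymbol 1 f y q}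
  have affine_mem (a b : ℝ) (i : ι) : a • 1 + b • cubeCoord i ∈ L :=
    ⟨_, ((HasSymbol.unit .one f).smul a).add ((HasSymbol.generator f i).smul b)⟩
  have separates : L.SeparatesPointsStrongly := by
    intro v s t
    rcases eq_or_ne s t with rfl | hst
    · exact ⟨v s • 1, ⟨_, (HasSymbol.unit .one f).smul _⟩, by simp, by simp⟩
    · obtain ⟨i, hi⟩ := Function.ne_iff.1 hst
      have hi' : (t i : ℝ) - s i ≠ 0 := sub_ne_zero.2 fun h => hi (Subtype.ext h.symm)
      refine ⟨_, affine_mem (v s - (v t - v s) / (t i - s i) * s i) ((v t - v s) / (t i - s i)) i,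
        by simp, ?_⟩
      simp only [ContinuousMap.add_apply, ContinuousMap.smul_apply, ContinuousMap.one_apply,
        cubeCoord_apply, smul_eq_mul]
      field_simp
      ring
  have closure_eq : closure L = ⊤ :=
    ContinuousMap.sublattice_closure_eq_top L ⟨1, _, HasSymbol.unit .one f⟩
      (fun _ ⟨_, h⟩ _ ⟨_, h'⟩ => ⟨_, h.inf h' .one⟩)
      (fun _ ⟨_, h⟩ _ ⟨_, h'⟩ => ⟨_, h.sup h' .one⟩) separates
  have closed : IsClosed L := isClosed_setOf_exists_hasSymbol .one harch hcomplete f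
  have mem : q ∈ closure L := closure_eq ▸ mem_univ q
  exact closed.closure_subset mem

end Symbol

section SymbolMul

variable {A ι : Type*} [NonUnitalCommRing A] [Lattice A] [Module ℝ A] [IsScalarTower ℝ A A]
  [Fintype ι]

/-- The operator `x ↦ x * e ^ n` for `e = absSum f`. An element with symbol `q` with respect to it
is of the form `e ^ (n + 1) * q (f / e)`. -/
def unitMulPow (f : ι → A) (n : ℕ) : Module.End ℝ A := LinearMap.mulRight ℝ (absSum f) ^ n

theorem unitMulPow_zero (f : ι → A) : unitMulPow f 0 = 1 := pow_zero _

theorem unitMulPow_succ (f : ι → A) (n : ℕ) :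
    unitMulPow f (n + 1) = LinearMap.mulRight ℝ (absSum f) * unitMulPow f n := pow_succ' _ _

theorem unitMulPow_succ_apply (f : ι → A) (n : ℕ) (x : A) :
    unitMulPow f (n + 1) x = unitMulPow f n x * absSum f := by
  rw [unitMulPow_succ, Module.End.mul_apply, LinearMap.mulRight_apply]

theorem unitMulPow_absSum_mul (f : ι → A) (n : ℕ) (x : A) :
    unitMulPow f n (absSum f) * x = unitMulPow f (n + 1) x := by
  induction n with
  | zero => rw [unitMulPow_succ_apply, unitMulPow_zero, Module.End.one_apply, Module.End.one_apply,
      mul_comm]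
  | succ n ih => rw [unitMulPow_succ_apply, mul_right_comm, ih, ← unitMulPow_succ_apply]

variable [IsOrderedAddMonoid A]

theorem IsFAlgebra.isPosOrthomorphism_unitMulPow (hA : IsFAlgebra A) (f : ι → A) (n : ℕ) :
    IsPosOrthomorphism (unitMulPow f n) :=
  (hA.isPosOrthomorphism_mulRight (absSum_nonneg f)).pow n

variable [PosSMulMono ℝ A] {f : ι → A} {y y' : A} {q q' : C(Cube ι, ℝ)} {n : ℕ}

theorem IsNegligible.smul_unit_mul {r : Cube ι → A} (hr : IsNegligible 1 f r)
    (hA : IsFAlgebra A) (q : C(Cube ι, ℝ)) (n : ℕ) :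
    IsNegligible (unitMulPow f (n + 1)) f fun t => q t • unitMulPow f n (absSum f) * r t := by
  have negligible_unit_mul := hr.map (hA.isPosOrthomorphism_unitMulPow f (n + 1))
  rw [mul_one] at negligible_unit_mul
  refine negligible_unit_mul.of_abs_le ‖q‖ fun t => ?_
  rw [smul_mul_assoc, unitMulPow_absSum_mul, abs_real_smul]
  exact smul_le_smul_of_nonneg_right (q.norm_coe_le_norm t) (abs_nonneg _)

variable [SMulCommClass ℝ A A]

theorem IsNegligible.mul_const {r : Cube ι → A} (hr : IsNegligible (unitMulPow f n) f r)
    (hA : IsFAlgebra A) {c : ℝ} (hy : |y| ≤ c • absSum f) :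
    IsNegligible (unitMulPow f (n + 1)) f fun t => r t * y := by
  have negligible_abs_mul_unit : IsNegligible (unitMulPow f (n + 1)) f fun t => |r t| * absSum f :=
    unitMulPow_succ f n ▸ hr.abs.map (hA.isPosOrthomorphism_mulRight (absSum_nonneg f))
  refine negligible_abs_mul_unit.of_abs_le c fun t => ?_
  have hrt : 0 ≤ |r t| * absSum f := hA.mul_nonneg _ _ (abs_nonneg _) (absSum_nonneg f)
  calc |r t * y| ≤ |r t| * |y| := hA.abs_mul_le _ _
    _ ≤ |r t| * (c • absSum f) := (hA.isPosOrthomorphism_mulLeft (abs_nonneg (r t))).monotone hy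
    _ = c • |(|r t| * absSum f)| := by rw [mul_smul_comm, abs_of_nonneg hrt]

theorem HasSymbol.mul (hy : HasSymbol (unitMulPow f n) f y q) (hy' : HasSymbol 1 f y' q')
    (hA : IsFAlgebra A) (harch : IsArchimedeanLattice A) :
    HasSymbol (unitMulPow f (n + 1)) f (y * y') (q * q') := by
  have split (t : Cube ι) : y * y' - (q * q') t • unitMulPow f (n + 1) (absSum f) =
      (y - q t • unitMulPow f n (absSum f)) * y' +
        q t • unitMulPow f n (absSum f) * (y' - q' t • absSum f) := by
    rw [ContinuousMap.mul_apply, ← unitMulPow_absSum_mul]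
    simp only [sub_mul, mul_sub, smul_mul_assoc, mul_smul_comm, mul_smul, smul_comm (q t)]
    abel
  simpa only [HasSymbol, split, Module.End.one_apply] using
    (IsNegligible.mul_const hy hA (hy'.abs_le_norm_smul .one harch)).add
      (IsNegligible.smul_unit_mul hy' hA q n)

theorem HasSymbol.foldProd (hA : IsFAlgebra A) (harch : IsArchimedeanLattice A) :
    ∀ {n : ℕ} {g : Fin (n + 1) → A} {q : Fin (n + 1) → C(Cube ι, ℝ)},
      (∀ i, HasSymbol 1 f (g i) (q i)) →
        HasSymbol (unitMulPow f n) f (foldProd (n + 1) g) (∏ i, q i)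
  | 0, g, q, h => by simpa [unitMulPow_zero, _root_.foldProd] using h 0
  | n + 1, g, q, h => by
    rw [Fin.prod_univ_castSucc, _root_.foldProd]
    exact (HasSymbol.foldProd hA harch fun i => h i.castSucc).mul (h (Fin.last _)) hA harch

end SymbolMul

section RealPower

theorem sub_pow_succ_le_two_pow_mul (n : ℕ) {s t : ℝ} (h : t ≤ s) :
    (s - t) ^ (n + 1) ≤ 2 ^ n * (s * |s| ^ n - t * |t| ^ n) := by
  have one_le : (1 : ℝ) ≤ 2 ^ n := one_le_pow₀ one_le_two
  have of_nonneg {s t : ℝ} (ht : 0 ≤ t) (h : t ≤ s) :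
      (s - t) ^ (n + 1) ≤ 2 ^ n * (s ^ (n + 1) - t ^ (n + 1)) := by
    have superadd := pow_add_pow_le (sub_nonneg.2 h) ht n.succ_ne_zero
    rw [sub_add_cancel] at superadd
    have diff_nonneg : 0 ≤ s ^ (n + 1) - t ^ (n + 1) := sub_nonneg.2 (pow_le_pow_left₀ ht h _)
    exact (le_sub_iff_add_le.2 superadd).trans (le_mul_of_one_le_left diff_nonneg one_le)
  have signed_of_nonneg {x : ℝ} (hx : 0 ≤ x) : x * |x| ^ n = x ^ (n + 1) := by
    rw [abs_of_nonneg hx, pow_succ']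
  have signed_of_nonpos {x : ℝ} (hx : x ≤ 0) : x * |x| ^ n = -(-x) ^ (n + 1) := by
    rw [abs_of_nonpos hx, pow_succ', neg_mul, neg_neg]
  rcases le_total 0 t with ht | ht
  · rw [signed_of_nonneg ht, signed_of_nonneg (ht.trans h)]
    exact of_nonneg ht h
  rcases le_total 0 s with hs | hs
  · rw [signed_of_nonneg hs, signed_of_nonpos ht, sub_neg_eq_add, sub_eq_add_neg]
    exact add_pow_le hs (neg_nonneg.2 ht) (n + 1)
  · rw [signed_of_nonpos hs, signed_of_nonpos ht, neg_sub_neg, ← neg_sub_neg t s]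
    exact of_nonneg (neg_nonneg.2 hs) (neg_le_neg h)

theorem monotone_mul_abs_pow (n : ℕ) : Monotone fun x : ℝ => x * |x| ^ n := fun t s h => by
  have := (pow_nonneg (sub_nonneg.2 h) _).trans (sub_pow_succ_le_two_pow_mul n h)
  exact sub_nonneg.1 (nonneg_of_mul_nonneg_right this (by positivity))

theorem abs_sub_pow_succ_le_two_pow_mul (n : ℕ) (s t : ℝ) :
    |s - t| ^ (n + 1) ≤ 2 ^ n * |s * |s| ^ n - t * |t| ^ n| := by
  wlog h : t ≤ s generalizing s t
  · rw [abs_sub_comm s, abs_sub_comm (s * _)]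
    exact this t s (le_of_not_ge h)
  rw [abs_of_nonneg (sub_nonneg.2 h), abs_of_nonneg (sub_nonneg.2 (monotone_mul_abs_pow n h))]
  exact sub_pow_succ_le_two_pow_mul n h

theorem exists_continuousMap_mul_abs_pow_eq {X : Type*} [TopologicalSpace X] (n : ℕ) (Q : C(X, ℝ)) :
    ∃ q : C(X, ℝ), q * |q| ^ n = Q := by
  have hr : (0 : ℝ) ≤ ((n + 1 : ℕ) : ℝ)⁻¹ := by positivity
  have hr' : ((n + 1 : ℕ) : ℝ)⁻¹ ≠ 0 := by positivity
  let root (x : ℝ) : ℝ := x ^ ((n + 1 : ℕ) : ℝ)⁻¹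
  have root_pow {x : ℝ} (hx : 0 ≤ x) : root x * |root x| ^ n = x := by
    rw [abs_of_nonneg (Real.rpow_nonneg hx _), ← pow_succ',
      Real.rpow_inv_natCast_pow hx n.succ_ne_zero]
  have root_zero : root 0 = 0 := Real.zero_rpow hr'
  have root_continuous : Continuous root := Real.continuous_rpow_const hr
  have root_pos : Continuous fun x => root (Q x)⁺ := root_continuous.comp (by fun_prop)
  have root_neg : Continuous fun x => root (Q x)⁻ := root_continuous.comp (by fun_prop)
  refine ⟨⟨fun x => root (Q x)⁺ - root (Q x)⁻, root_pos.sub root_neg⟩, ?_⟩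
  ext x
  simp only [ContinuousMap.mul_apply, ContinuousMap.pow_apply, ContinuousMap.abs_apply,
    ContinuousMap.coe_mk]
  rcases le_total 0 (Q x) with hx | hx
  · rw [posPart_of_nonneg hx, negPart_of_nonneg hx, root_zero, sub_zero, root_pow hx]
  · rw [posPart_of_nonpos hx, negPart_of_nonpos hx, root_zero, zero_sub, abs_neg, neg_mul,
      root_pow (neg_nonneg.2 hx), neg_neg]

end RealPower

section SignedPower

variable {A : Type*} [NonUnitalCommRing A]

theorem foldProd_mul_foldProd :
    ∀ (p : ℕ) (g h : Fin p → A), foldProd p g * foldProd p h = foldProd p (g * h)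
  | 0, _, _ => mul_zero 0
  | 1, _, _ => rfl
  | n + 2, g, h => by
    rw [foldProd, foldProd, mul_mul_mul_comm, foldProd_mul_foldProd (n + 1)]
    rfl

variable [Lattice A]

/-- The signed power `v * |v| ^ n`, an odd and increasing replacement for `v ^ (n + 1)`, written as
an `(n + 1)`-fold product because there is no `|v| ^ 0`. -/
def signedPow (n : ℕ) (v : A) : A := foldProd (n + 1) (Fin.cons v fun _ => |v|)

variable [IsOrderedAddMonoid A]

theorem foldProd_const_abs (n : ℕ) (v : A) : foldProd (n + 1) (fun _ => |v|) = signedPow n |v| := by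
  rw [signedPow, abs_abs]
  congr 1
  exact (Fin.cons_self_tail fun _ => |v|).symm

variable [Module ℝ A] [PosSMulMono ℝ A] [IsScalarTower ℝ A A] [SMulCommClass ℝ A A]

theorem HasSymbol.signedPow {ι : Type*} [Fintype ι] {f : ι → A} {v : A} {q : C(Cube ι, ℝ)}
    (hv : HasSymbol 1 f v q) (hA : IsFAlgebra A) (harch : IsArchimedeanLattice A) (n : ℕ) :
    HasSymbol (unitMulPow f n) f (signedPow n v) (q * |q| ^ n) := by
  have prod_eq : ∏ i, Fin.cons (α := fun _ => C(Cube ι, ℝ)) q (fun _ : Fin n => |q|) i =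
      q * |q| ^ n := by
    rw [Fin.prod_univ_succ]
    simp only [Fin.cons_zero, Fin.cons_succ, Finset.prod_const, Finset.card_univ, Fintype.card_fin]
  rw [← prod_eq]
  exact HasSymbol.foldProd hA harch (Fin.cases hv fun _ => hv.abs .one)

section SymbolicCalculus

variable (hA : IsFAlgebra A) (harch : IsArchimedeanLattice A) (n : ℕ)
include hA harch

theorem signedPow_smul (c : ℝ) (v : A) : signedPow n (c • v) = (c * |c| ^ n) • signedPow n v := by
  let q : C(Cube (Fin 1), ℝ) := cubeCoord 0
  have hv : HasSymbol 1 ![v] v q := HasSymbol.generator ![v] 0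
  have symbol_eq : c • q * |c • q| ^ n = (c * |c| ^ n) • (q * |q| ^ n) := by
    ext t
    simp [abs_mul, mul_pow, mul_assoc, mul_left_comm]
  refine ((hv.smul c).signedPow hA harch n).ext ?_ (hA.isPosOrthomorphism_unitMulPow _ n) harch
  exact symbol_eq ▸ (hv.signedPow hA harch n).smul (c * |c| ^ n)

theorem signedPow_zero : signedPow n (0 : A) = 0 := by
  simpa using signedPow_smul hA harch n 0 (0 : A)

theorem signedPow_neg (v : A) : signedPow n (-v) = -signedPow n v := by
  simpa using signedPow_smul hA harch n (-1) v

theorem signedPow_sup (u v : A) : signedPow n (u ⊔ v) = signedPow n u ⊔ signedPow n v := by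
  let q : Fin 2 → C(Cube (Fin 2), ℝ) := cubeCoord
  have hu : HasSymbol 1 ![u, v] u (q 0) := HasSymbol.generator ![u, v] 0
  have hv : HasSymbol 1 ![u, v] v (q 1) := HasSymbol.generator ![u, v] 1
  have hT := hA.isPosOrthomorphism_unitMulPow ![u, v] n
  have symbol_eq : (q 0 ⊔ q 1) * |q 0 ⊔ q 1| ^ n = q 0 * |q 0| ^ n ⊔ q 1 * |q 1| ^ n := by
    ext t
    exact (monotone_mul_abs_pow n).map_sup _ _
  refine ((hu.sup hv .one).signedPow hA harch n).ext ?_ hT harch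
  exact symbol_eq ▸ (hu.signedPow hA harch n).sup (hv.signedPow hA harch n) hT

theorem signedPow_abs_sub_le (u v : A) :
    signedPow n |u - v| ≤ (2 ^ n : ℝ) • |signedPow n u - signedPow n v| := by
  have hu : HasSymbol 1 ![u, v] u (cubeCoord 0) := HasSymbol.generator ![u, v] 0
  have hv : HasSymbol 1 ![u, v] v (cubeCoord 1) := HasSymbol.generator ![u, v] 1
  have hT := hA.isPosOrthomorphism_unitMulPow ![u, v] n
  refine (((hu.sub hv).abs .one).signedPow hA harch n).mono
    ((((hu.signedPow hA harch n).sub (hv.signedPow hA harch n)).abs hT).smul (2 ^ n)) hT harch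
    fun t => ?_
  simpa [pow_succ'] using abs_sub_pow_succ_le_two_pow_mul n (t 0 : ℝ) (t 1)

theorem signedPow_mono : Monotone (signedPow n : A → A) := fun u v h => by
  rw [← sup_eq_right, ← signedPow_sup hA harch, sup_eq_right.2 h]

theorem signedPow_injective (hsemiprime : IsSemiprimeAlgebra A) :
    Function.Injective (signedPow n : A → A) := fun u v h => by
  have signedPow_nonneg : 0 ≤ signedPow n |u - v| :=
    (signedPow_zero hA harch n).symm.trans_le (signedPow_mono hA harch n (abs_nonneg _))
  have signedPow_nonpos := signedPow_abs_sub_le hA harch n u v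
  rw [h, sub_self, abs_zero, smul_zero] at signedPow_nonpos
  have foldProd_eq_zero : foldProd (n + 1) (fun _ => |u - v|) = 0 :=
    (foldProd_const_abs n _).trans (signedPow_nonpos.antisymm signedPow_nonneg)
  have := hsemiprime _ ⟨n + 1, n.succ_pos, foldProd_eq_zero⟩
  exact sub_eq_zero.1 (eq_zero_of_abs_nonpos this.le)

theorem signedPow_le_signedPow_iff (hsemiprime : IsSemiprimeAlgebra A) {u v : A} :
    signedPow n u ≤ signedPow n v ↔ u ≤ v := by
  refine ⟨fun h => ?_, fun h => signedPow_mono hA harch n h⟩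
  rw [← sup_eq_right, ← signedPow_sup hA harch] at h
  exact sup_eq_right.1 (signedPow_injective hA harch n hsemiprime h)

end SymbolicCalculus

section Roots

variable {n : ℕ}

theorem HasSymbol.exists_signedPow_eq {ι : Type*} [Fintype ι] {f : ι → A} {y : A}
    {Q : C(Cube ι, ℝ)} (hy : HasSymbol (unitMulPow f n) f y Q) (hA : IsFAlgebra A)
    (harch : IsArchimedeanLattice A) (hcomplete : IsUniformlyComplete A) :
    ∃ v q, HasSymbol 1 f v q ∧ q * |q| ^ n = Q ∧ _root_.signedPow n v = y := by
  obtain ⟨q, rfl⟩ := exists_continuousMap_mul_abs_pow_eq n Q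
  obtain ⟨v, hv⟩ := exists_hasSymbol harch hcomplete f q
  exact ⟨v, q, hv, rfl,
    (hv.signedPow hA harch n).ext hy (hA.isPosOrthomorphism_unitMulPow f n) harch⟩

theorem exists_signedPow_eq_foldProd (hA : IsFAlgebra A) (harch : IsArchimedeanLattice A)
    (hcomplete : IsUniformlyComplete A) (g : Fin (n + 1) → A) :
    ∃ v, |v| ≤ absSum g ∧ signedPow n v = foldProd (n + 1) g := by
  obtain ⟨v, q, hv, hq, hvg⟩ := (HasSymbol.foldProd hA harch
    (HasSymbol.generator g)).exists_signedPow_eq hA harch hcomplete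
  refine ⟨v, ?_, hvg⟩
  have norm_q_le : ‖q‖ ≤ 1 := (ContinuousMap.norm_le q zero_le_one).2 fun t => by
    have prod_le : |∏ i, (t i : ℝ)| ≤ 1 := by
      rw [Finset.abs_prod]
      exact Finset.prod_le_one (fun _ _ => abs_nonneg _) fun i _ => abs_le.2 (t i).2
    have pow_eq : |q t| ^ (n + 1) = |∏ i, (t i : ℝ)| := by
      have := congrArg abs (DFunLike.congr_fun hq t)
      simpa [abs_mul, pow_succ'] using this
    exact (pow_le_one_iff_of_nonneg (abs_nonneg _) n.succ_ne_zero).1 (pow_eq.trans_le prod_le)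
  calc |v| ≤ ‖q‖ • absSum g := hv.abs_le_norm_smul .one harch
    _ ≤ (1 : ℝ) • absSum g := smul_le_smul_of_nonneg_right norm_q_le (absSum_nonneg g)
    _ = absSum g := one_smul ℝ _

theorem foldProducts_eq_image_signedPow (hA : IsFAlgebra A) (harch : IsArchimedeanLattice A)
    (hcomplete : IsUniformlyComplete A) {S : Set A} (hS : LatticeOrderedAddCommGroup.IsSolid S)
    (hadd : ∀ a b, a ∈ S → b ∈ S → a + b ∈ S) :
    foldProducts (n + 1) S = signedPow n '' S := by
  have abs_mem {v : A} (hv : v ∈ S) : |v| ∈ S := hS hv (abs_abs v).le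
  apply Subset.antisymm
  · rintro _ ⟨g, hg, rfl⟩
    obtain ⟨v, hv, hvg⟩ := exists_signedPow_eq_foldProd hA harch hcomplete g
    have absSum_mem : absSum g ∈ S :=
      Finset.sum_induction_nonempty _ (· ∈ S) hadd Finset.univ_nonempty fun i _ => abs_mem (hg i)
    exact ⟨v, hS absSum_mem (hv.trans (le_abs_self _)), hvg⟩
  · rintro _ ⟨v, hv, rfl⟩
    exact ⟨_, Fin.cases hv fun _ => abs_mem hv, rfl⟩

theorem foldProducts_univ (hA : IsFAlgebra A) (harch : IsArchimedeanLattice A)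
    (hcomplete : IsUniformlyComplete A) :
    foldProducts (n + 1) (univ : Set A) = range (signedPow n) := by
  rw [foldProducts_eq_image_signedPow hA harch hcomplete (fun _ _ _ _ => mem_univ _)
    fun _ _ _ _ => mem_univ _, image_univ]

end Roots

section PowerSubalgebra

variable (hA : IsFAlgebra A) (harch : IsArchimedeanLattice A) (hcomplete : IsUniformlyComplete A)
  (n : ℕ)

/-- The set of signed powers, or equally of `(n + 1)`-fold products, as a lattice subalgebra. -/
def signedPowSubalgebra : LatticeSubalgebra A where
  carrier := range (signedPow n)
  zero_mem' := ⟨0, signedPow_zero hA harch n⟩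
  add_mem' := by
    rintro _ _ ⟨u, rfl⟩ ⟨v, rfl⟩
    obtain ⟨w, _, -, -, hw⟩ := (((HasSymbol.generator ![u, v] 0).signedPow hA harch n).add
      ((HasSymbol.generator ![u, v] 1).signedPow hA harch n)).exists_signedPow_eq hA harch hcomplete
    exact ⟨w, hw⟩
  mul_mem' := by
    rintro _ _ ⟨u, rfl⟩ ⟨v, rfl⟩
    rw [← foldProducts_univ hA harch hcomplete]
    exact ⟨_, fun _ => mem_univ _, (foldProd_mul_foldProd (n + 1) _ _).symm⟩
  smul_mem' c := by
    rintro _ ⟨v, rfl⟩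
    obtain ⟨w, _, -, -, hw⟩ := (((HasSymbol.generator ![v] 0).signedPow hA harch n).smul
      c).exists_signedPow_eq hA harch hcomplete
    exact ⟨w, hw⟩
  sup_mem' := by
    rintro _ _ ⟨u, rfl⟩ ⟨v, rfl⟩
    exact ⟨u ⊔ v, signedPow_sup hA harch n u v⟩
  inf_mem' := by
    rintro _ _ ⟨u, rfl⟩ ⟨v, rfl⟩
    refine ⟨-(-u ⊔ -v), ?_⟩
    rw [signedPow_neg hA harch, signedPow_sup hA harch, signedPow_neg hA harch,
      signedPow_neg hA harch, neg_sup, neg_neg, neg_neg]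

/-- The signed power as an order isomorphism from `A` onto the algebra of signed powers. -/
noncomputable def signedPowOrderIso (hsemiprime : IsSemiprimeAlgebra A) :
    A ≃o (signedPowSubalgebra hA harch hcomplete n).toNonUnitalSubalgebra where
  toEquiv := Equiv.ofInjective _ (signedPow_injective hA harch n hsemiprime)
  map_rel_iff' := signedPow_le_signedPow_iff hA harch n hsemiprime

theorem isHomogeneousOrderIso_signedPowOrderIso (hsemiprime : IsSemiprimeAlgebra A) :
    IsHomogeneousOrderIso (signedPowOrderIso hA harch hcomplete n hsemiprime) (n + 1) where
  degree_pos := by positivity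
  map_neg v := Subtype.ext (signedPow_neg hA harch n v)
  map_smul c v hc := Subtype.ext <| by
    refine (signedPow_smul hA harch n c v).trans ?_
    rw [abs_of_pos hc, ← pow_succ', ← Real.rpow_natCast, Nat.cast_succ]
    rfl

end PowerSubalgebra

end SignedPower

theorem corollary7 {A : Type*} [NonUnitalRing A] [Lattice A] [IsOrderedAddMonoid A]
    [Module ℝ A] [PosSMulMono ℝ A] [IsScalarTower ℝ A A] [SMulCommClass ℝ A A]
    (hA : IsFAlgebra A) (harch : IsArchimedeanLattice A) (hcomplete : IsUniformlyComplete A)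
    (hsemiprime : IsSemiprimeAlgebra A) (p : ℕ) (hp : 2 ≤ p) :
    ∃ P : LatticeSubalgebra A,
      (P.toNonUnitalSubalgebra : Set A) = foldProducts p Set.univ ∧
      foldProducts p (finiteElements A) =
        Subtype.val '' finiteElements P.toNonUnitalSubalgebra ∧
      foldProducts p (totallyFiniteElements A) =
        Subtype.val '' totallyFiniteElements P.toNonUnitalSubalgebra ∧
      foldProducts p (selfMajorizingDifferences A) =
        Subtype.val '' selfMajorizingDifferences P.toNonUnitalSubalgebra := by
  obtain ⟨n, rfl⟩ : ∃ n, p = n + 1 := Nat.exists_eq_succ_of_ne_zero (by omega)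
  let _ : NonUnitalCommRing A :=
    { ‹NonUnitalRing A› with mul_comm := fun a b => (hA.commute harch a b).eq }
  have hF := isHomogeneousOrderIso_signedPowOrderIso hA harch hcomplete n hsemiprime
  refine ⟨signedPowSubalgebra hA harch hcomplete n,
    (foldProducts_univ hA harch hcomplete).symm, ?_, ?_, ?_⟩
  · rw [← hF.image_finiteElements, image_image]
    exact foldProducts_eq_image_signedPow hA harch hcomplete isSolid_finiteElements
      fun _ _ => add_mem_finiteElements
  · rw [← hF.image_totallyFiniteElements, image_image]
    exact foldProducts_eq_image_signedPow hA harch hcomplete isSolid_totallyFiniteElements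
      fun _ _ => add_mem_totallyFiniteElements
  · rw [← hF.image_selfMajorizingDifferences, image_image]
    exact foldProducts_eq_image_signedPow hA harch hcomplete isSolid_selfMajorizingDifferences
      fun _ _ => add_mem_selfMajorizingDifferences
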